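/- Let $G$ be a finite group and let $H$ be a normal subgroup of $G$ such that $G/H$ is cyclic; put $n=|G/H|$. For each divisor $c$ of $n$, let $K_c$ be the unique subgroup of $G$ containing $H$ as a subgroup of index $c$, let $\Gamma_c$ be any coset of $H$ which has order $c$ as an element of $G/H$, let $T_c$ be the number of conjugacy classes of $G$ contained in $\Gamma_c$, and let $S_c$ be the number of conjugacy classes of $G$ contained in $K_c$. For a divisor $d$ of $n$, let $S^*_d$ be the number of conjugacy classes of the group $K_d$ (under its own conjugation action). Then, for every divisor $d$ of $n$, $$S^*_d=n\sum_{c\mid n}\ \sum_{a\mid c}\mu(c/a)\,\frac{\gcd(a,d)}{\operatorname{lcm}(a,d)}\,T_c$$ and $$S^*_d=n\sum_{c\mid n}\ \sum_{a\mid c}\ \sum_{b\mid c}\frac{\mu(c/a)\,\mu(c/b)}{\phi(c)}\,\frac{\gcd(a,d)}{\operatorname{lcm}(a,d)}\,S_b,$$ where $\mu$ is the Möbius function and $\phi$ is Euler's totient function. -/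

import Mathlib

/-- The number of conjugacy classes of `G` that are contained in the subset `X` of `G`. -/
noncomputable def numClassesIn {G : Type*} [Group G] (X : Set G) : ℕ :=
  {C : ConjClasses G | C.carrier ⊆ X}.ncard

/-- The coset `q` of `H` in `G`, as a subset of `G`. -/
def cosetSet {G : Type*} [Group G] (H : Subgroup G) (q : G ⧸ H) : Set G :=
  {g : G | (QuotientGroup.mk g : G ⧸ H) = q}

/-!
Let `f : G → Q` be the quotient map by `H`. For `y ∈ H` let `M_y ≤ Q` be the image of the
centralizer of `y`, and let `w_y` be the order of its centralizer in `H`. The number of commuting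
pairs in `f⁻¹{α} × f⁻¹{β}` is the sum of `w_y` over the `y` with `α, β ∈ M_y`: for `α = 1` this
counts the pairs by their first entry, and the Euclidean algorithm reduces the general case to it.
Summing over `β`, or over both `α` and `β`, one finds that `T_c * |G|` is the sum of `|M_y| * w_y`
over the `y` with `c ∣ |M_y|`, and that `S*_d * |K_d| = ∑_y gcd(|M_y|, d)² * w_y`. The first formula
follows by Möbius expansion of `gcd(e, d)² = d * e * (gcd(e, d) / lcm(e, d))` over the divisors of
`e`, and the second one by Möbius inversion of `S_b = ∑_{k ∣ b} φ(k) * T_k`.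
-/

open Finset

section CommutingPairs

variable {G : Type*} [Group G]

/-- The number of commuting pairs in `X × Y`. All class numbers below are, up to the order of a
group, such counts. -/
noncomputable def commCount (X Y : Set G) : ℕ :=
  {p : G × G | p.1 ∈ X ∧ p.2 ∈ Y ∧ Commute p.1 p.2}.ncard

lemma commCount_comm (X Y : Set G) : commCount X Y = commCount Y X := by
  rw [commCount, commCount, ← Set.ncard_image_of_injective _ Prod.swap_injective,
    Set.image_swap_eq_preimage_swap]
  congr 1
  ext p
  exact ⟨fun ⟨hX, hY, h⟩ => ⟨hY, hX, h.symm⟩, fun ⟨hY, hX, h⟩ => ⟨hX, hY, h.symm⟩⟩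

lemma commCount_iUnion_left [Finite G] {ι : Type*} [Fintype ι] {s : ι → Set G}
    (hs : Pairwise (Function.onFun Disjoint s)) (Y : Set G) :
    commCount (⋃ i, s i) Y = ∑ i, commCount (s i) Y := by
  have hunion : {p : G × G | p.1 ∈ ⋃ i, s i ∧ p.2 ∈ Y ∧ Commute p.1 p.2} =
      ⋃ i, {p : G × G | p.1 ∈ s i ∧ p.2 ∈ Y ∧ Commute p.1 p.2} := by
    ext p
    simp
  rw [commCount, hunion, Set.ncard_iUnion_of_finite (fun _ => Set.toFinite _),
    finsum_eq_sum_of_fintype]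
  · rfl
  · exact fun i j hij => Set.disjoint_left.2 fun p hi hj =>
      Set.disjoint_left.1 (hs hij) hi.1 hj.1

lemma commCount_eq_sum_ncard_inter_centralizer [Finite G] (X Y : Set G) [Fintype X] :
    commCount X Y = ∑ x : X, (Y ∩ Subgroup.centralizer {(x : G)}).ncard := by
  have hdisj : Pairwise (Function.onFun Disjoint fun x : X => ({(x : G)} : Set G)) :=
    fun x y hxy => Set.disjoint_singleton.2 (Subtype.coe_injective.ne hxy)
  have hX := commCount_iUnion_left hdisj Y
  rw [Set.iUnion_of_singleton_coe] at hX
  rw [hX]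
  refine sum_congr rfl fun x _ => ?_
  have himage : {p : G × G | p.1 ∈ ({(x : G)} : Set G) ∧ p.2 ∈ Y ∧ Commute p.1 p.2} =
      Prod.mk (x : G) '' (Y ∩ Subgroup.centralizer {(x : G)}) := by
    ext ⟨a, b⟩
    simp only [Set.mem_ofPred_eq, Set.mem_singleton_iff, Set.mem_image, Set.mem_inter_iff,
      SetLike.mem_coe, Subgroup.mem_centralizer_singleton_iff, Prod.mk.injEq, commute_iff_eq]
    grind
  rw [commCount, himage, Set.ncard_image_of_injective _ (Prod.mk_right_injective (x : G))]

lemma commCount_subgroup_self (L : Subgroup G) :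
    commCount (L : Set G) L = Nat.card (ConjClasses L) * Nat.card L := by
  rw [← card_comm_eq_card_conjClasses_mul_card]
  exact Nat.card_congr
    { toFun := fun p => ⟨(⟨p.1.1, p.2.1⟩, ⟨p.1.2, p.2.2.1⟩), Subtype.ext p.2.2.2⟩
      invFun := fun p => ⟨(p.1.1, p.1.2), p.1.1.2, p.1.2.2, congrArg Subtype.val p.2⟩
      left_inv := fun _ => rfl
      right_inv := fun _ => rfl }

lemma natCard_carrier_mul_natCard_centralizer [Finite G] (g : G) :
    Nat.card (ConjClasses.mk g).carrier * Nat.card (Subgroup.centralizer {g}) = Nat.card G := by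
  rw [← ConjAct.orbit_eq_carrier_conjClasses, Subgroup.nat_card_centralizer_nat_card_stabilizer,
    Nat.card_coe_set_eq, ← MulAction.index_stabilizer, Subgroup.index_mul_card]
  rfl

lemma commCount_carrier_univ [Finite G] (C : ConjClasses G) :
    commCount C.carrier Set.univ = Nat.card G := by
  have := Fintype.ofFinite C.carrier
  have hcentralizer (x : C.carrier) :
      (Set.univ ∩ (Subgroup.centralizer {(x : G)} : Set G)).ncard =
        Nat.card G / Nat.card C.carrier := by
    have hx := natCard_carrier_mul_natCard_centralizer (x : G)
    rw [ConjClasses.mem_carrier_iff_mk_eq.1 x.2] at hx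
    have : Nonempty C.carrier := ⟨x⟩
    rw [Set.univ_inter, ← Nat.card_coe_set_eq]
    exact Nat.eq_div_of_mul_eq_right Nat.card_pos.ne' hx
  rw [commCount_eq_sum_ncard_inter_centralizer, sum_congr rfl fun x _ => hcentralizer x,
    sum_const, card_univ, ← Nat.card_eq_fintype_card, smul_eq_mul]
  obtain ⟨g, rfl⟩ := ConjClasses.exists_rep C
  exact Nat.mul_div_cancel' ⟨_, (natCard_carrier_mul_natCard_centralizer g).symm⟩

lemma numClassesIn_mul_natCard [Finite G] {X : Set G}
    (hX : ∀ x ∈ X, (ConjClasses.mk x).carrier ⊆ X) :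
    numClassesIn X * Nat.card G = commCount X Set.univ := by
  have := Fintype.ofFinite {C : ConjClasses G | C.carrier ⊆ X}
  have hunion : X = ⋃ C : {C : ConjClasses G | C.carrier ⊆ X}, C.1.carrier := by
    refine Set.Subset.antisymm (fun x hx => ?_) (Set.iUnion_subset fun C => C.2)
    exact Set.mem_iUnion.2 ⟨⟨ConjClasses.mk x, hX x hx⟩, ConjClasses.mem_carrier_mk⟩
  have hdisj : Pairwise (Function.onFun Disjoint
      fun C : {C : ConjClasses G | C.carrier ⊆ X} => C.1.carrier) := by
    refine fun C D hCD => Set.disjoint_left.2 fun x hC hD => hCD (Subtype.ext ?_)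
    rw [← ConjClasses.mem_carrier_iff_mk_eq.1 hC, ← ConjClasses.mem_carrier_iff_mk_eq.1 hD]
  conv_rhs => rw [hunion]
  rw [commCount_iUnion_left hdisj, sum_congr rfl fun C _ => commCount_carrier_univ C.1, sum_const,
    card_univ, ← Nat.card_eq_fintype_card, Nat.card_coe_set_eq, smul_eq_mul, numClassesIn]

end CommutingPairs

section CyclicGroup

variable {Q : Type*} [Group Q] [Finite Q] [IsCyclic Q]

lemma mem_subgroup_iff_orderOf_dvd_natCard (A : Subgroup Q) (x : Q) :
    x ∈ A ↔ orderOf x ∣ Nat.card A := by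
  classical
  have := Fintype.ofFinite Q
  refine ⟨A.orderOf_dvd_natCard, fun hx => ?_⟩
  have hsub : ({x | x ∈ A} : Finset Q) ⊆ ({x | x ^ Nat.card A = 1} : Finset Q) := by
    intro y hy
    simp only [mem_filter, mem_univ, true_and] at hy ⊢
    exact orderOf_dvd_iff_pow_eq_one.1 (A.orderOf_dvd_natCard hy)
  have hcard : #{x : Q | x ^ Nat.card A = 1} ≤ #{x : Q | x ∈ A} := by
    refine (IsCyclic.card_pow_eq_one_le Nat.card_pos).trans ?_
    rw [Nat.card_eq_fintype_card, Fintype.card_subtype]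
  have hmem : x ∈ ({x | x ∈ A} : Finset Q) := by
    rw [eq_of_subset_of_card_le hsub hcard]
    simpa using orderOf_dvd_iff_pow_eq_one.1 hx
  simpa using hmem

lemma natCard_inf_eq_gcd (A B : Subgroup Q) :
    Nat.card (A ⊓ B : Subgroup Q) = (Nat.card A).gcd (Nat.card B) := by
  refine Nat.dvd_antisymm (Nat.dvd_gcd (Subgroup.card_dvd_of_le inf_le_left)
    (Subgroup.card_dvd_of_le inf_le_right)) ?_
  obtain ⟨q, hq⟩ := IsCyclic.exists_ofOrder_eq_natCard (α := Q)
  have hgcd : (Nat.card A).gcd (Nat.card B) ∣ orderOf q :=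
    (Nat.gcd_dvd_left _ _).trans (hq ▸ A.card_subgroup_dvd_card)
  rw [← orderOf_pow_orderOf_div (orderOf_pos q).ne' hgcd]
  refine Subgroup.orderOf_dvd_natCard _ (Subgroup.mem_inf.2 ?_)
  rw [mem_subgroup_iff_orderOf_dvd_natCard, mem_subgroup_iff_orderOf_dvd_natCard,
    orderOf_pow_orderOf_div (orderOf_pos q).ne' hgcd]
  exact ⟨Nat.gcd_dvd_left _ _, Nat.gcd_dvd_right _ _⟩

lemma sum_comp_orderOf [Fintype Q] {M : Type*} [AddCommMonoid M] (F : ℕ → M) :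
    ∑ x : Q, F (orderOf x) = ∑ c ∈ (Nat.card Q).divisors, c.totient • F c := by
  rw [← sum_fiberwise_of_maps_to (t := (Nat.card Q).divisors) (g := orderOf) fun x _ =>
    Nat.mem_divisors.2 ⟨orderOf_dvd_natCard x, Nat.card_pos.ne'⟩]
  refine sum_congr rfl fun c hc => ?_
  rw [sum_congr rfl fun x hx => congrArg F (mem_filter.1 hx).2, sum_const,
    IsCyclic.card_orderOf_eq_totient (Nat.card_eq_fintype_card (α := Q) ▸
      Nat.dvd_of_mem_divisors hc)]

end CyclicGroup

section Fibers

variable {G Q : Type*} [Group G] [Group Q] (f : G →* Q)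

lemma commCount_comap_left [Finite G] (A : Subgroup Q) [Fintype A] (Y : Set G) :
    commCount (A.comap f) Y = ∑ α : A, commCount (f ⁻¹' {(α : Q)}) Y := by
  have hunion : (A.comap f : Set G) = ⋃ α : A, f ⁻¹' {(α : Q)} := by
    ext x
    simp
  rw [hunion, commCount_iUnion_left]
  exact fun _ _ hαβ => (Set.disjoint_singleton.2 (Subtype.val_injective.ne hαβ)).preimage f

lemma commCount_comap_right [Finite G] (A : Subgroup Q) [Fintype A] (X : Set G) :
    commCount X (A.comap f) = ∑ α : A, commCount X (f ⁻¹' {(α : Q)}) := by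
  simp only [commCount_comm X, commCount_comap_left]

lemma ncard_fiber_inter_subgroup (L : Subgroup G) (α : Q) [Decidable (α ∈ L.map f)] :
    (f ⁻¹' {α} ∩ L).ncard = if α ∈ L.map f then Nat.card (f.ker ⊓ L : Subgroup G) else 0 := by
  split_ifs with hα
  · obtain ⟨x, hx, rfl⟩ := hα
    have htranslate : f ⁻¹' {f x} ∩ L = (x * ·) '' (f.ker ⊓ L : Subgroup G) := by
      ext y
      simp only [Set.image_mul_left, Set.mem_preimage, Set.mem_inter_iff, Set.mem_singleton_iff,
        SetLike.mem_coe, Subgroup.mem_inf, MonoidHom.mem_ker, map_mul, map_inv,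
        L.mul_mem_cancel_left (L.inv_mem hx), inv_mul_eq_one, eq_comm (a := f y)]
    rw [htranslate, Set.ncard_image_of_injective _ (mul_right_injective x)]
    rfl
  · have hempty : f ⁻¹' {α} ∩ L = ∅ :=
      Set.eq_empty_of_forall_notMem fun x hx => hα ⟨x, hx.2, hx.1⟩
    rw [hempty, Set.ncard_empty]

/-- The image in `Q` of the centralizer of `y`: for surjective `f`, the stabilizer under `Q` of the
`f.ker`-conjugacy class of an element `y` of `f.ker`. -/
def centralizerImage (y : G) : Subgroup Q :=
  (Subgroup.centralizer {y}).map f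

/-- The order of the centralizer of `y` in `f.ker`. -/
noncomputable def kerCentralizerCard (y : G) : ℕ :=
  Nat.card (f.ker ⊓ Subgroup.centralizer {y} : Subgroup G)

lemma commCount_fiber_mul_right (α β : Q) :
    commCount (f ⁻¹' {α}) (f ⁻¹' {α * β}) = commCount (f ⁻¹' {α}) (f ⁻¹' {β}) := by
  symm
  refine Nat.card_congr (((Equiv.refl G).prodShear Equiv.mulLeft).subtypeEquiv fun p => ?_)
  simp only [Set.mem_ofPred_eq, Set.mem_preimage, Set.mem_singleton_iff, Equiv.prodShear_apply,
    Equiv.refl_apply, Equiv.coe_mulLeft, map_mul, commute_iff_eq, mul_assoc, mul_right_inj]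
  refine and_congr_right fun hα => ?_
  rw [hα, mul_right_inj]

lemma commCount_fiber_pow_mul_right (α β : Q) (k : ℕ) :
    commCount (f ⁻¹' {α}) (f ⁻¹' {α ^ k * β}) = commCount (f ⁻¹' {α}) (f ⁻¹' {β}) := by
  induction k with
  | zero => rw [pow_zero, one_mul]
  | succ k ih => rw [pow_succ', mul_assoc, commCount_fiber_mul_right, ih]

open scoped Classical in
lemma commCount_fiber_one_left [Finite G] [Fintype f.ker] (β : Q) :
    commCount (f ⁻¹' {1}) (f ⁻¹' {β}) =
      ∑ y : f.ker, if β ∈ centralizerImage f y then kerCentralizerCard f y else 0 := by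
  rw [← MonoidHom.coe_ker, commCount_eq_sum_ncard_inter_centralizer]
  exact sum_congr rfl fun y _ => ncard_fiber_inter_subgroup f _ β

open scoped Classical in
-- Both sides are symmetric and invariant under `(α, β) ↦ (α, α * β)`, so the Euclidean algorithm on
-- the exponents with respect to a generator of `Q` reduces the identity to the case `α = 1`.
lemma commCount_fiber_fiber [Finite G] [Finite Q] [IsCyclic Q] [Fintype f.ker] (α β : Q) :
    commCount (f ⁻¹' {α}) (f ⁻¹' {β}) = ∑ y : f.ker,
      if α ∈ centralizerImage f y ∧ β ∈ centralizerImage f y then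
        kerCentralizerCard f y else 0 := by
  obtain ⟨q, hq⟩ := IsCyclic.exists_monoid_generator (α := Q)
  obtain ⟨i, rfl⟩ := Submonoid.mem_powers_iff _ _ |>.1 (hq α)
  obtain ⟨j, rfl⟩ := Submonoid.mem_powers_iff _ _ |>.1 (hq β)
  induction i, j using Nat.gcd.induction with
  | H0 j => simp only [pow_zero, commCount_fiber_one_left, one_mem, true_and]
  | H1 i j _ ih =>
    have hj : q ^ j = (q ^ i) ^ (j / i) * q ^ (j % i) := by
      rw [← pow_mul, ← pow_add, Nat.div_add_mod]
    rw [hj, commCount_fiber_pow_mul_right, commCount_comm, ih]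
    refine sum_congr rfl fun y _ => ?_
    refine if_congr (and_comm.trans (and_congr_right fun hi => ?_)) rfl rfl
    exact (Subgroup.mul_mem_cancel_left _ (pow_mem hi _)).symm

lemma carrier_subset_preimage [IsMulCommutative Q] (S : Set Q) :
    ∀ x ∈ f ⁻¹' S, (ConjClasses.mk x).carrier ⊆ f ⁻¹' S := by
  intro x hx y hy
  rw [ConjClasses.mem_carrier_iff_mk_eq, ConjClasses.mk_eq_mk_iff_isConj] at hy
  obtain ⟨c, hc⟩ := isConj_iff.1 (f.map_isConj hy)
  rw [IsMulCommutative.is_comm.comm c, mul_inv_cancel_right] at hc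
  rwa [Set.mem_preimage, hc]

lemma numClassesIn_comap [Finite G] [IsMulCommutative Q] (A : Subgroup Q) [Fintype A] :
    numClassesIn (A.comap f : Set G) = ∑ α : A, numClassesIn (f ⁻¹' {(α : Q)}) := by
  refine Nat.eq_of_mul_eq_mul_right (Nat.card_pos (α := G)) ?_
  rw [Subgroup.coe_comap, numClassesIn_mul_natCard (carrier_subset_preimage f A), sum_mul,
    ← Subgroup.coe_comap, commCount_comap_left]
  exact sum_congr rfl fun α _ => (numClassesIn_mul_natCard (carrier_subset_preimage f {α.1})).symm

open scoped Classical in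
lemma sum_ite_mem_subgroup (A B : Subgroup Q) [Fintype A] (k : ℕ) :
    (∑ α : A, if (α : Q) ∈ B then k else 0) = Nat.card (A ⊓ B : Subgroup Q) * k := by
  rw [← sum_filter, sum_const, smul_eq_mul, ← Fintype.card_subtype, ← Nat.card_eq_fintype_card]
  congr 1
  exact Nat.card_congr (Equiv.subtypeSubtypeEquivSubtypeInter (· ∈ A) (· ∈ B))

variable [Finite G] [Finite Q] [IsCyclic Q] [Fintype f.ker]

open scoped Classical in
lemma commCount_fiber_comap (α : Q) (B : Subgroup Q) :
    commCount (f ⁻¹' {α}) (B.comap f) = ∑ y : f.ker,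
      if α ∈ centralizerImage f y then
        Nat.card (B ⊓ centralizerImage f y : Subgroup Q) * kerCentralizerCard f y else 0 := by
  have := Fintype.ofFinite B
  simp only [commCount_comap_right, commCount_fiber_fiber, ite_and]
  rw [sum_comm]
  refine sum_congr rfl fun y _ => ?_
  rw [sum_ite_irrel, sum_ite_mem_subgroup, sum_const_zero]

open scoped Classical in
lemma numClassesIn_fiber_mul_natCard (α : Q) :
    numClassesIn (f ⁻¹' {α}) * Nat.card G = ∑ y : f.ker,
      if α ∈ centralizerImage f y then
        Nat.card (centralizerImage f y) * kerCentralizerCard f y else 0 := by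
  have h := commCount_fiber_comap f α ⊤
  simp only [Subgroup.comap_top, Subgroup.coe_top, top_inf_eq] at h
  rw [numClassesIn_mul_natCard (carrier_subset_preimage f {α}), h]

lemma natCard_conjClasses_comap_mul_natCard (A : Subgroup Q) :
    Nat.card (ConjClasses (A.comap f)) * Nat.card (A.comap f) = ∑ y : f.ker,
      Nat.card (A ⊓ centralizerImage f y : Subgroup Q) ^ 2 * kerCentralizerCard f y := by
  classical
  have := Fintype.ofFinite A
  rw [← commCount_subgroup_self, commCount_comap_left]
  simp only [commCount_fiber_comap]
  rw [sum_comm]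
  refine sum_congr rfl fun y _ => ?_
  rw [sum_ite_mem_subgroup, sq, mul_assoc]

end Fibers

section Arithmetic

open ArithmeticFunction

lemma sum_divisors_sum_moebius_mul {R : Type*} [NonAssocRing R] (g : ℕ → R) {e : ℕ} (he : 0 < e) :
    ∑ c ∈ e.divisors, ∑ a ∈ c.divisors, (moebius (c / a) : R) * g a = g e := by
  refine sum_eq_iff_sum_mul_moebius_eq.2 (fun c _ => ?_) e he
  exact Nat.sum_divisorsAntidiagonal' fun x y => (moebius x : R) * g y

lemma sum_moebius_mul_sum_divisors {R : Type*} [NonAssocRing R] (g : ℕ → R) {c : ℕ} (hc : 0 < c) :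
    ∑ b ∈ c.divisors, (moebius (c / b) : R) * ∑ a ∈ b.divisors, g a = g c := by
  refine Eq.trans ?_ (sum_eq_iff_sum_mul_moebius_eq.1 (fun _ _ => rfl) c hc)
  exact (Nat.sum_divisorsAntidiagonal' fun x y => (moebius x : R) * ∑ a ∈ y.divisors, g a).symm

/-- The Möbius transform of `a ↦ gcd(a, d) / lcm(a, d)`: the coefficient of `n * T_c` in the class
number `S*_d`. -/
def moebiusGcdDivLcm (d c : ℕ) : ℚ :=
  ∑ a ∈ c.divisors, (moebius (c / a) : ℚ) * ((a.gcd d : ℚ) / (a.lcm d : ℚ))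

lemma mul_sum_moebiusGcdDivLcm {e d : ℕ} (he : e ≠ 0) (hd : d ≠ 0) :
    (d * e : ℚ) * ∑ c ∈ e.divisors, moebiusGcdDivLcm d c = (e.gcd d : ℚ) ^ 2 := by
  have hlcm : (e.lcm d : ℚ) ≠ 0 := Nat.cast_ne_zero.2 (Nat.lcm_ne_zero he hd)
  have hmul : (e.gcd d : ℚ) * e.lcm d = e * d := by exact_mod_cast Nat.gcd_mul_lcm e d
  simp only [moebiusGcdDivLcm]
  rw [sum_divisors_sum_moebius_mul (fun a => (a.gcd d : ℚ) / (a.lcm d : ℚ))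
    (Nat.pos_of_ne_zero he), mul_comm (d : ℚ), ← hmul, sq]
  field_simp

end Arithmetic

section ClassNumbers

variable {G Q : Type*} [Group G] [Group Q]

lemma natCard_comap {f : G →* Q} (hf : Function.Surjective f) (A : Subgroup Q) :
    Nat.card (A.comap f) = Nat.card A * Nat.card f.ker := by
  have hindex := Subgroup.relIndex_mul_relIndex ⊥ f.ker (A.comap f) bot_le
    (Subgroup.ker_le_comap f A)
  rw [Subgroup.relIndex_ker, Subgroup.map_comap_eq_self_of_surjective hf] at hindex
  rw [← Subgroup.relIndex_bot_left (A.comap f), ← hindex, Subgroup.relIndex_bot_left, mul_comm]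

variable [Finite G] [Finite Q] [IsCyclic Q]

lemma numClassesIn_fiber_eq_of_orderOf_eq (f : G →* Q) {α β : Q} (h : orderOf α = orderOf β) :
    numClassesIn (f ⁻¹' {α}) = numClassesIn (f ⁻¹' {β}) := by
  classical
  have := Fintype.ofFinite f.ker
  have hmem (A : Subgroup Q) : α ∈ A ↔ β ∈ A := by
    rw [mem_subgroup_iff_orderOf_dvd_natCard, h, ← mem_subgroup_iff_orderOf_dvd_natCard]
  refine Nat.eq_of_mul_eq_mul_right (Nat.card_pos (α := G)) ?_
  rw [numClassesIn_fiber_mul_natCard, numClassesIn_fiber_mul_natCard]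
  exact sum_congr rfl fun y _ => if_congr (hmem _) rfl rfl

variable {Γ : ℕ → Q}
  (hΓ : ∀ c, c ∣ Nat.card Q → orderOf (Γ c) = c)
include hΓ

lemma sum_divisors_mul_numClassesIn_fiber (f : G →* Q) [Fintype f.ker] (F : ℕ → ℚ) :
    (∑ c ∈ (Nat.card Q).divisors, F c * numClassesIn (f ⁻¹' {Γ c})) * Nat.card G =
      ∑ y : f.ker, (Nat.card (centralizerImage f y) : ℚ) *
        (∑ c ∈ (Nat.card (centralizerImage f y)).divisors, F c) * kerCentralizerCard f y := by
  classical
  have hT (c : ℕ) (hc : c ∈ (Nat.card Q).divisors) :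
      F c * numClassesIn (f ⁻¹' {Γ c}) * Nat.card G = ∑ y : f.ker,
        if c ∣ Nat.card (centralizerImage f y) then
          (Nat.card (centralizerImage f y) : ℚ) * F c * kerCentralizerCard f y else 0 := by
    rw [mul_assoc, ← Nat.cast_mul, numClassesIn_fiber_mul_natCard, Nat.cast_sum, mul_sum]
    refine sum_congr rfl fun y _ => ?_
    have hmem := mem_subgroup_iff_orderOf_dvd_natCard (centralizerImage f y) (Γ c)
    rw [hΓ c (Nat.dvd_of_mem_divisors hc)] at hmem
    rw [if_congr hmem rfl rfl]
    split_ifs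
    · push_cast
      ring
    · simp
  rw [sum_mul, sum_congr rfl hT, sum_comm]
  refine sum_congr rfl fun y _ => ?_
  rw [← sum_filter, Nat.divisors_filter_dvd_of_dvd Nat.card_pos.ne'
    (Subgroup.card_subgroup_dvd_card _), mul_sum, sum_mul]

lemma natCard_conjClasses_comap {f : G →* Q} (hf : Function.Surjective f) (A : Subgroup Q) :
    (Nat.card (ConjClasses (A.comap f)) : ℚ) = Nat.card Q * ∑ c ∈ (Nat.card Q).divisors,
      moebiusGcdDivLcm (Nat.card A) c * numClassesIn (f ⁻¹' {Γ c}) := by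
  have := Fintype.ofFinite f.ker
  have hcard : Nat.card G = Nat.card Q * Nat.card f.ker := by
    simpa using natCard_comap hf ⊤
  have hcomap : (Nat.card (A.comap f) : ℚ) ≠ 0 := Nat.cast_ne_zero.2 Nat.card_pos.ne'
  refine mul_right_cancel₀ hcomap ?_
  calc (Nat.card (ConjClasses (A.comap f)) * Nat.card (A.comap f) : ℚ)
      = ∑ y : f.ker, ((Nat.card (centralizerImage f y)).gcd (Nat.card A) : ℚ) ^ 2 *
          kerCentralizerCard f y := by
        rw [← Nat.cast_mul, natCard_conjClasses_comap_mul_natCard]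
        simp only [natCard_inf_eq_gcd, Nat.gcd_comm (Nat.card A)]
        push_cast
        rfl
    _ = Nat.card A * ((∑ c ∈ (Nat.card Q).divisors,
          moebiusGcdDivLcm (Nat.card A) c * numClassesIn (f ⁻¹' {Γ c})) * Nat.card G) := by
        rw [sum_divisors_mul_numClassesIn_fiber hΓ, mul_sum]
        refine sum_congr rfl fun y _ => ?_
        rw [← mul_sum_moebiusGcdDivLcm Nat.card_pos.ne' Nat.card_pos.ne', ← mul_assoc, ← mul_assoc]
    _ = _ := by
        rw [hcard, natCard_comap hf]
        push_cast
        ring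

lemma numClassesIn_comap_eq_sum_totient_mul (f : G →* Q) (A : Subgroup Q) :
    numClassesIn (A.comap f : Set G) =
      ∑ k ∈ (Nat.card A).divisors, k.totient * numClassesIn (f ⁻¹' {Γ k}) := by
  have := Fintype.ofFinite A
  rw [numClassesIn_comap]
  refine Eq.trans ?_ (sum_comp_orderOf (Q := A) fun k => numClassesIn (f ⁻¹' {Γ k}))
  refine sum_congr rfl fun α _ => numClassesIn_fiber_eq_of_orderOf_eq f ?_
  rw [hΓ _ ((orderOf_dvd_natCard α).trans A.card_subgroup_dvd_card), Subgroup.orderOf_coe]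

lemma numClassesIn_fiber_mul_totient (f : G →* Q) {A : ℕ → Subgroup Q}
    (hA : ∀ b, b ∣ Nat.card Q → Nat.card (A b) = b) {c : ℕ} (hc : c ∣ Nat.card Q) :
    (numClassesIn (f ⁻¹' {Γ c}) : ℚ) * c.totient = ∑ b ∈ c.divisors,
      (ArithmeticFunction.moebius (c / b) : ℚ) * numClassesIn ((A b).comap f : Set G) := by
  rw [mul_comm, ← sum_moebius_mul_sum_divisors
    (fun k => (k.totient : ℚ) * numClassesIn (f ⁻¹' {Γ k})) (Nat.pos_of_dvd_of_pos hc Nat.card_pos)]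
  refine sum_congr rfl fun b hb => ?_
  rw [numClassesIn_comap_eq_sum_totient_mul hΓ, hA b ((Nat.dvd_of_mem_divisors hb).trans hc)]
  push_cast
  rfl

end ClassNumbers

theorem theorem3 {G : Type*} [Group G] [Finite G] (H : Subgroup G) [H.Normal]
    [IsCyclic (G ⧸ H)] (n : ℕ) (hn : n = Nat.card (G ⧸ H))
    -- `K c` is the subgroup of `G` that contains `H` with index `c`
    (K : ℕ → Subgroup G) (hHK : ∀ c, c ∣ n → H ≤ K c)
    (hK : ∀ c, c ∣ n → H.relIndex (K c) = c)
    -- `Γ c` is any coset of order `c` in `G ⧸ H`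
    (Γ : ℕ → G ⧸ H) (hΓ : ∀ c, c ∣ n → orderOf (Γ c) = c)
    (d : ℕ) (hd : d ∣ n) :
    (Nat.card (ConjClasses (K d)) : ℚ) =
        n * ∑ c ∈ n.divisors, ∑ a ∈ c.divisors,
          (ArithmeticFunction.moebius (c / a) : ℚ) *
            ((Nat.gcd a d : ℚ) / (Nat.lcm a d : ℚ)) * (numClassesIn (cosetSet H (Γ c)) : ℚ) ∧
    (Nat.card (ConjClasses (K d)) : ℚ) =
        n * ∑ c ∈ n.divisors, ∑ a ∈ c.divisors, ∑ b ∈ c.divisors,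
          ((ArithmeticFunction.moebius (c / a) : ℚ) * (ArithmeticFunction.moebius (c / b) : ℚ) /
              (Nat.totient c : ℚ)) *
            ((Nat.gcd a d : ℚ) / (Nat.lcm a d : ℚ)) * (numClassesIn (K b : Set G) : ℚ) := by
  subst hn
  set f := QuotientGroup.mk' H
  have hcomap {c : ℕ} (hc : c ∣ Nat.card (G ⧸ H)) : ((K c).map f).comap f = K c :=
    Subgroup.comap_map_eq_self ((QuotientGroup.ker_mk' H).trans_le (hHK c hc))
  have hcard (c : ℕ) (hc : c ∣ Nat.card (G ⧸ H)) : Nat.card ((K c).map f) = c := by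
    rw [← Subgroup.relIndex_ker, QuotientGroup.ker_mk', hK c hc]
  have hS := natCard_conjClasses_comap hΓ (QuotientGroup.mk'_surjective H) ((K d).map f)
  rw [hcomap hd, hcard d hd] at hS
  refine ⟨hS.trans ?_, hS.trans ?_⟩ <;>
    refine congrArg _ (sum_congr rfl fun c hc => ?_) <;>
    rw [moebiusGcdDivLcm, sum_mul]
  · rfl
  · have hcn := Nat.dvd_of_mem_divisors hc
    have hφ : (c.totient : ℚ) ≠ 0 :=
      Nat.cast_ne_zero.2 (Nat.totient_pos.2 (Nat.pos_of_mem_divisors hc)).ne'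
    rw [eq_div_of_mul_eq hφ (numClassesIn_fiber_mul_totient hΓ f hcard hcn)]
    refine sum_congr rfl fun a _ => ?_
    rw [sum_div, mul_sum]
    refine sum_congr rfl fun b hb => ?_
    rw [hcomap ((Nat.dvd_of_mem_divisors hb).trans hcn)]
    ring
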